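/- Let $M$ be a matroid on a finite ground set, and let $\mathcal{Z}(M)$ be the lattice, ordered by inclusion, of its cyclic flats, that is, of the flats $X$ of $M$ for which the restriction $M|X$ has no isthmuses (coloops). Suppose that (a) $\mathcal{Z}(M)$ has order dimension at most two, i.e. it can be embedded, as an ordered set, in a product of at most two chains; and (b) for each antichain $\mathcal{A}$ of $\mathcal{Z}(M)$, the sublattice of $\mathcal{Z}(M)$ generated by $\mathcal{A}$ is distributive. Then $M$ and all of its minors, as well as their duals, are transversal. (A matroid is transversal if its independent sets are exactly the partial transversals of some finite family of subsets of its ground set.) -/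

import Mathlib

universe u

namespace Matroid

/-- A flat `X` of `M` is cyclic if the restriction `M|X` has no isthmuses (coloops). -/
def IsCyclicFlat {α : Type u} (M : Matroid α) (X : Set α) : Prop :=
  M.IsFlat X ∧ ∀ e, ¬ (M ↾ X).IsColoop e

/-- A flat is cyclic iff each of its elements lies in a circuit contained in it. -/
theorem isCyclicFlat_iff {α : Type u} {M : Matroid α} {X : Set α} :
    M.IsCyclicFlat X ↔ M.IsFlat X ∧ ∀ e ∈ X, ∃ C ⊆ X, M.IsCircuit C ∧ e ∈ C := by
  unfold IsCyclicFlat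
  refine and_congr_right fun hX ↦ ?_
  have hXE : X ⊆ M.E := hX.subset_ground
  constructor
  · intro h e he
    have h1 := h e
    rw [isColoop_iff_forall_notMem_isCircuit (by simpa using he)] at h1
    push Not at h1
    obtain ⟨C, hC, heC⟩ := h1
    rw [restrict_isCircuit_iff hXE] at hC
    exact ⟨C, hC.2, hC.1, heC⟩
  · intro h e he
    have heX : e ∈ X := by simpa using he.mem_ground
    obtain ⟨C, hCX, hC, heC⟩ := h e heX
    exact he.notMem_isCircuit (hC.isCircuit_restrict_of_subset hCX) heC

/-- The set `𝒵(M)` of cyclic flats of `M`. -/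
def CyclicFlats {α : Type u} (M : Matroid α) : Type u := {X : Set α // M.IsCyclicFlat X}

/-- Cyclic flats are ordered by inclusion. -/
instance {α : Type u} (M : Matroid α) : PartialOrder M.CyclicFlats :=
  inferInstanceAs (PartialOrder {X : Set α // M.IsCyclicFlat X})

theorem isCyclicFlat_closure_union {α : Type u} {M : Matroid α} {X Y : Set α}
    (hX : M.IsCyclicFlat X) (hY : M.IsCyclicFlat Y) :
    M.IsCyclicFlat (M.closure (X ∪ Y)) := by
  rw [isCyclicFlat_iff] at *
  have hsub : X ∪ Y ⊆ M.closure (X ∪ Y) :=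
    M.subset_closure _ (Set.union_subset hX.1.subset_ground hY.1.subset_ground)
  refine ⟨isFlat_closure _, fun e he ↦ ?_⟩
  by_cases heU : e ∈ X ∪ Y
  · rcases heU with h | h
    · obtain ⟨C, hC, h1⟩ := hX.2 e h
      exact ⟨C, (hC.trans Set.subset_union_left).trans hsub, h1⟩
    · obtain ⟨C, hC, h1⟩ := hY.2 e h
      exact ⟨C, (hC.trans Set.subset_union_right).trans hsub, h1⟩
  · obtain ⟨C, hC, h1⟩ := exists_isCircuit_of_mem_closure he heU
    exact ⟨C, hC.trans (Set.insert_subset he hsub), h1⟩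

theorem isCyclicFlat_sUnion_isCircuit {α : Type u} {M : Matroid α} {X Y : Set α}
    (hX : M.IsCyclicFlat X) (hY : M.IsCyclicFlat Y) :
    M.IsCyclicFlat (⋃₀ {C | M.IsCircuit C ∧ C ⊆ X ∩ Y}) := by
  rw [isCyclicFlat_iff] at *
  have hsub : ⋃₀ {C | M.IsCircuit C ∧ C ⊆ X ∩ Y} ⊆ X ∩ Y := Set.sUnion_subset fun C hC ↦ hC.2
  constructor
  · rw [isFlat_iff_closure_eq]
    refine Set.Subset.antisymm (fun e he ↦ ?_)
      (M.subset_closure _ (hsub.trans (Set.inter_subset_left.trans hX.1.subset_ground)))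
    by_contra hne
    obtain ⟨C, hC, hCc, heC⟩ := exists_isCircuit_of_mem_closure he hne
    have heX : e ∈ X := by
      rw [← hX.1.closure]
      exact M.closure_subset_closure (hsub.trans Set.inter_subset_left) he
    have heY : e ∈ Y := by
      rw [← hY.1.closure]
      exact M.closure_subset_closure (hsub.trans Set.inter_subset_right) he
    exact hne ⟨C, ⟨hCc, hC.trans (Set.insert_subset ⟨heX, heY⟩ hsub)⟩, heC⟩
  · rintro e ⟨C, hC, heC⟩
    exact ⟨C, Set.subset_sUnion_of_mem hC, hC.1, heC⟩

/-- The lattice of cyclic flats: the join of `X` and `Y` is the closure of `X ∪ Y`, and their meet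
is the union of the circuits contained in `X ∩ Y`. -/
instance {α : Type u} (M : Matroid α) : Lattice M.CyclicFlats where
  sup X Y := ⟨M.closure (X.1 ∪ Y.1), isCyclicFlat_closure_union X.2 Y.2⟩
  inf X Y := ⟨⋃₀ {C | M.IsCircuit C ∧ C ⊆ X.1 ∩ Y.1}, isCyclicFlat_sUnion_isCircuit X.2 Y.2⟩
  le_sup_left X Y := Set.subset_union_left.trans
    (M.subset_closure _ (Set.union_subset X.2.1.subset_ground Y.2.1.subset_ground))
  le_sup_right X Y := Set.subset_union_right.trans
    (M.subset_closure _ (Set.union_subset X.2.1.subset_ground Y.2.1.subset_ground))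
  sup_le X Y Z hX hY := by
    have h := M.closure_subset_closure (Set.union_subset hX hY)
    rw [Z.2.1.closure] at h
    exact h
  inf_le_left X Y := Set.sUnion_subset fun C hC ↦ hC.2.trans Set.inter_subset_left
  inf_le_right X Y := Set.sUnion_subset fun C hC ↦ hC.2.trans Set.inter_subset_right
  le_inf X Y Z hY hZ := fun e he ↦ by
    obtain ⟨C, hCX, hC, heC⟩ := (isCyclicFlat_iff.1 X.2).2 e he
    exact ⟨C, ⟨hC, hCX.trans (Set.subset_inter hY hZ)⟩, heC⟩

/-- `M` is transversal if there is a finite family of subsets of the ground set whose partial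
transversals are exactly the independent sets of `M`. -/
def IsTransversal {α : Type u} (M : Matroid α) : Prop :=
  ∃ (n : ℕ) (A : Fin n → Set α), (∀ i, A i ⊆ M.E) ∧
    ∀ I : Set α, M.Indep I ↔ ∃ f : I → Fin n, Function.Injective f ∧ ∀ e : I, (e : α) ∈ A (f e)

end Matroid

/-- The (order) dimension of an ordered set `P`: the least number of chains such that `P` embeds
in their product, and `⊤` if no finite number suffices. -/
noncomputable def orderDimension (P : Type u) [PartialOrder P] : ℕ∞ :=
  sInf {d : ℕ∞ | ∃ n : ℕ, d = n ∧ ∃ (C : Fin n → Type u) (_ : ∀ i, LinearOrder (C i)),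
    Nonempty (P ↪o ∀ i, C i)}

/-- The sublattice of `L` generated by the set `A`. -/
def generatedSublattice {L : Type u} [Lattice L] (A : Set L) : Sublattice L :=
  Sublattice.ofIsSublattice (latticeClosure A) isSublattice_latticeClosure

/-- The lattice `L` is distributive. -/
def IsDistributiveLattice (L : Type u) [Lattice L] : Prop :=
  ∀ x y z : L, x ⊓ (y ⊔ z) = (x ⊓ y) ⊔ (x ⊓ z)

/-! Weights β on the cyclic flats are fixed by Möbius inversion: those of the cyclic flats above X
sum to r(E) − r(X). The candidate presentation takes the complement of each cyclic flat F with
multiplicity β(F). By Hall's theorem it works once β ≥ 0 and, for every J, the cyclic flats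
containing J have total weight at most r(E) − r(J) (`isTransversal_of_weights`). Both follow from an
inequality of Mason–Ingleton type for antichains, `IsPlanarArrangement.sum_le_of_antichain`.

That inequality comes from submodularity by removing the elements of an antichain from right to
left. Dimension two supplies the left-to-right order, as a coordinate of the embedding;
distributivity supplies y ≤ (x ⊓ y) ⊔ z for x, y, z in that order. The resulting notion
`IsPlanarOrder` is self-dual, and contractions inherit enough of it for the inequality. Deletion
preserves transversality directly, so all minors and their duals are covered. -/

open Classical in
/-- Every function on a finite ordered set is the sum over upper sets of some function. -/
theorem exists_sum_le_eq {P : Type*} [Fintype P] [PartialOrder P] (g : P → ℤ) :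
    ∃ β : P → ℤ, ∀ x, ∑ y with x ≤ y, β y = g x := by
  let F : (x : P) → ((y : P) → y > x → ℤ) → ℤ := fun x ih ↦ g x - ∑ y : {y // y > x}, ih y.1 y.2
  refine ⟨wellFounded_gt.fix F, fun x ↦ ?_⟩
  have h1 : (Finset.univ.filter (x ≤ ·)) = insert x (Finset.univ.filter (x < ·)) := by
    ext y
    simp [le_iff_eq_or_lt, eq_comm]
  rw [h1, Finset.sum_insert (by simp), wellFounded_gt.fix_eq]
  have h2 : ∑ y with x < y, wellFounded_gt.fix F y
      = ∑ y : {y // y > x}, wellFounded_gt.fix F y.1 := by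
    rw [← Finset.sum_subtype_eq_sum_filter]
    exact Finset.sum_bij (fun y _ ↦ ⟨y.1, by simpa using y.2⟩) (by simp) (by simp) (by simp)
      (by simp)
  rw [h2]
  simp [F]

/-! ### Rank, weights on cyclic flats, and Hall's theorem -/

namespace Matroid

variable {α : Type u} {M N : Matroid α}

/-- The rank of a set, as an integer. -/
noncomputable def intRk (M : Matroid α) (X : Set α) : ℤ := ((M.eRk X).toNat : ℤ)

theorem exists_eRk_eq_intRk_eq (M : Matroid α) [M.Finite] (X : Set α) :
    ∃ n : ℕ, M.eRk X = n ∧ M.intRk X = n :=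
  ⟨_, (ENat.natCast_toNat (M.isRkFinite_set X).eRk_lt_top.ne).symm, rfl⟩

theorem intRk_mono [M.Finite] {X Y : Set α} (h : X ⊆ Y) : M.intRk X ≤ M.intRk Y := by
  have h1 := M.eRk_mono h
  obtain ⟨a, ha, ha'⟩ := M.exists_eRk_eq_intRk_eq X
  obtain ⟨b, hb, hb'⟩ := M.exists_eRk_eq_intRk_eq Y
  rw [ha, hb] at h1
  rw [ha', hb']
  exact_mod_cast h1

theorem intRk_submod (M : Matroid α) [M.Finite] (X Y : Set α) :
    M.intRk (X ∩ Y) + M.intRk (X ∪ Y) ≤ M.intRk X + M.intRk Y := by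
  have h1 := M.eRk_submod X Y
  obtain ⟨a, ha, ha'⟩ := M.exists_eRk_eq_intRk_eq X
  obtain ⟨b, hb, hb'⟩ := M.exists_eRk_eq_intRk_eq Y
  obtain ⟨c, hc, hc'⟩ := M.exists_eRk_eq_intRk_eq (X ∩ Y)
  obtain ⟨d, hd, hd'⟩ := M.exists_eRk_eq_intRk_eq (X ∪ Y)
  rw [ha, hb, hc, hd] at h1
  rw [ha', hb', hc', hd']
  exact_mod_cast h1

theorem intRk_closure (M : Matroid α) (X : Set α) : M.intRk (M.closure X) = M.intRk X := by
  rw [intRk, eRk_closure_eq, intRk]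

theorem intRk_le_of_subset_closure [M.Finite] {X Y : Set α} (h : X ⊆ M.closure Y) :
    M.intRk X ≤ M.intRk Y :=
  (intRk_mono h).trans_eq (intRk_closure M Y)

theorem Indep.intRk_eq {I : Finset α} (h : M.Indep (I : Set α)) : M.intRk I = I.card := by
  rw [intRk, h.eRk_eq_encard]
  simp

theorem IsCircuit.intRk_lt [M.Finite] {C : Finset α} (h : M.IsCircuit (C : Set α)) :
    M.intRk C < C.card := by
  have h1 := h.dep.eRk_lt_encard
  obtain ⟨a, ha, ha'⟩ := M.exists_eRk_eq_intRk_eq C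
  rw [ha, Set.encard_coe_eq_coe_finsetCard] at h1
  rw [ha']
  exact_mod_cast h1

instance [M.Finite] : Finite M.CyclicFlats :=
  Set.Finite.subset M.ground_finite.finite_subsets fun _ h ↦ h.1.subset_ground

theorem CyclicFlats.subset_ground (X : M.CyclicFlats) : X.1 ⊆ M.E := X.2.1.subset_ground

theorem CyclicFlats.closure_eq (X : M.CyclicFlats) : M.closure X.1 = X.1 := X.2.1.closure

theorem CyclicFlats.coe_sup (X Y : M.CyclicFlats) : (X ⊔ Y).1 = M.closure (X.1 ∪ Y.1) := rfl

theorem CyclicFlats.inf_subset (X Y : M.CyclicFlats) : (X ⊓ Y).1 ⊆ X.1 ∩ Y.1 :=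
  Set.sUnion_subset fun _ hC ↦ hC.2

/-- A linear arrangement `f` of the cyclic flats, with witnesses `m X Y` below `X ∩ Y`, under which
every antichain of cyclic flats behaves like one in a planar distributive lattice. -/
structure IsPlanarArrangement (N : Matroid α) {C : Type*} [LinearOrder C] (f : N.CyclicFlats → C)
    (m : N.CyclicFlats → N.CyclicFlats → Set α) : Prop where
  subset_inter : ∀ x y, m x y ⊆ x.1 ∩ y.1
  subset_sup : ∀ x y z, IncompRel (· ≤ ·) x y → IncompRel (· ≤ ·) y z →
    IncompRel (· ≤ ·) x z → f x ≤ f y → f y ≤ f z → y ≤ x ⊔ z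
  meet_subset : ∀ x y z, IncompRel (· ≤ ·) x y → IncompRel (· ≤ ·) y z →
    IncompRel (· ≤ ·) x z → f x ≤ f y → f y ≤ f z → m x z ⊆ y.1
  subset_closure : ∀ x y z, IncompRel (· ≤ ·) x y → IncompRel (· ≤ ·) y z →
    IncompRel (· ≤ ·) x z → f x ≤ f y → f y ≤ f z → y.1 ⊆ N.closure (m x y ∪ z.1)

variable {C : Type*} [LinearOrder C] {f : N.CyclicFlats → C}
  {m : N.CyclicFlats → N.CyclicFlats → Set α}

-- Induction removes the rightmost element z. With y the rightmost of the rest s, the up-sets of s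
-- and of z meet exactly in the up-set of y ⊔ z, so inclusion–exclusion adds r(y ⊔ z) − r(z) to the
-- bound for s. Submodularity for ⋂ s and z absorbs this, because y lies in the closure of ⋂ s ∪ z.
open Classical in
theorem IsPlanarArrangement.sum_le_of_antichain [N.Finite] [Fintype N.CyclicFlats]
    (h : N.IsPlanarArrangement f m) {β : N.CyclicFlats → ℤ}
    (hβ : ∀ X, ∑ Y with X ≤ Y, β Y = N.intRk N.E - N.intRk X.1) (A : Finset N.CyclicFlats) :
    IsAntichain (· ≤ ·) (A : Set N.CyclicFlats) → A.Nonempty →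
    ∑ Y with ∃ a ∈ A, a ≤ Y, β Y ≤ N.intRk N.E - N.intRk (⋂ a ∈ A, a.1) := by
  induction A using Finset.induction_on_max_value f with
  | empty => simp
  | insert z s hz hmax ih =>
    intro hanti _
    have inc : ∀ a ∈ insert z s, ∀ b ∈ insert z s, a ≠ b → IncompRel (· ≤ ·) a b :=
      fun a ha b hb hab ↦ ⟨hanti ha hb hab, hanti hb ha hab.symm⟩
    rcases s.eq_empty_or_nonempty with rfl | hs
    · simp [hβ]
    specialize ih (hanti.subset (by simp)) hs
    obtain ⟨y, hy, hymax⟩ := s.exists_max_image f hs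
    have incs : ∀ a ∈ s, ∀ b ∈ s, a ≠ b → IncompRel (· ≤ ·) a b :=
      fun a ha b hb ↦ inc a (by simp [ha]) b (by simp [hb])
    have incz : ∀ a ∈ s, IncompRel (· ≤ ·) a z :=
      fun a ha ↦ inc a (by simp [ha]) z (by simp) fun h ↦ hz (h ▸ ha)
    have key : ∀ a ∈ s, y ≤ a ⊔ z := by
      intro a ha
      by_cases hay : a = y
      · exact hay ▸ le_sup_left
      exact h.subset_sup a y z (incs a ha y hy hay) (incz y hy) (incz a ha) (hymax a ha) (hmax y hy)
    have hclos : y.1 ⊆ N.closure ((⋂ a ∈ s, a.1) ∪ z.1) := by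
      rcases (s.erase y).eq_empty_or_nonempty with he | hne
      · have hs' : s = {y} := by
          rw [← Finset.insert_erase hy, he]; rfl
        subst hs'
        simp only [Finset.mem_singleton, Set.iInter_iInter_eq_left]
        exact Set.subset_union_left.trans
          (N.subset_closure _ (Set.union_subset y.subset_ground z.subset_ground))
      -- With x leftmost, every other member of s lies between x and y, hence contains `m x y`; so
      -- `m x y` lies in ⋂ s.
      · obtain ⟨x, hx, hxmin⟩ := (s.erase y).exists_min_image f hne
        have hxy := Finset.ne_of_mem_erase hx
        have hxs := Finset.mem_of_mem_erase hx
        refine (h.subset_closure x y z (incs x hxs y hy hxy) (incz y hy) (incz x hxs)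
          (hymax x hxs) (hmax y hy)).trans (N.closure_subset_closure
            (Set.union_subset_union_left _ (Set.subset_iInter₂ fun w hw ↦ ?_)))
        by_cases hwx : w = x
        · exact hwx ▸ (h.subset_inter x y).trans Set.inter_subset_left
        by_cases hwy : w = y
        · exact hwy ▸ (h.subset_inter x y).trans Set.inter_subset_right
        exact h.meet_subset x w y (incs x hxs w hw (Ne.symm hwx)) (incs w hw y hy hwy)
          (incs x hxs y hy hxy) (hxmin w (by simp [hwy, hw])) (hymax w hw)
    have hunion : N.intRk (y ⊔ z).1 ≤ N.intRk ((⋂ a ∈ s, a.1) ∪ z.1) := by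
      rw [CyclicFlats.coe_sup, intRk_closure]
      refine intRk_le_of_subset_closure (Set.union_subset hclos ?_)
      refine Set.subset_union_right.trans (N.subset_closure _ (Set.union_subset ?_ z.subset_ground))
      exact (Set.biInter_subset_of_mem hy).trans y.subset_ground
    have hsub := N.intRk_submod (⋂ a ∈ s, a.1) z.1
    have hU : Finset.univ.filter (fun Y ↦ ∃ a ∈ insert z s, a ≤ Y)
        = Finset.univ.filter (fun Y ↦ ∃ a ∈ s, a ≤ Y) ∪ Finset.univ.filter (z ≤ ·) := by
      ext Y
      simp [or_comm]
    have hI : Finset.univ.filter (fun Y ↦ ∃ a ∈ s, a ≤ Y) ∩ Finset.univ.filter (z ≤ ·)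
        = Finset.univ.filter (y ⊔ z ≤ ·) := by
      ext Y
      simp only [Finset.mem_inter, Finset.mem_filter, Finset.mem_univ, true_and]
      constructor
      · rintro ⟨⟨a, ha, haY⟩, hzY⟩
        exact sup_le ((key a ha).trans (sup_le haY hzY)) hzY
      · exact fun hY ↦ ⟨⟨y, hy, le_sup_left.trans hY⟩, le_sup_right.trans hY⟩
    have hsum := Finset.sum_union_inter (s₁ := Finset.univ.filter (fun Y ↦ ∃ a ∈ s, a ≤ Y))
      (s₂ := Finset.univ.filter (z ≤ ·)) (f := β)
    rw [← hU, hI, hβ, hβ] at hsum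
    rw [Finset.set_biInter_insert, Set.inter_comm]
    linarith

-- The minimal elements of a nonempty `U` form an antichain generating it, and their intersection
-- contains `J`.
open Classical in
theorem IsPlanarArrangement.sum_le_of_isUpperSet [N.Finite] [Fintype N.CyclicFlats]
    (h : N.IsPlanarArrangement f m) {β : N.CyclicFlats → ℤ}
    (hβ : ∀ X, ∑ Y with X ≤ Y, β Y = N.intRk N.E - N.intRk X.1) {J : Set α} (hJ : J ⊆ N.E)
    {U : Finset N.CyclicFlats} (hU : IsUpperSet (U : Set N.CyclicFlats)) (hJU : ∀ Y ∈ U, J ⊆ Y.1) :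
    ∑ Y ∈ U, β Y ≤ N.intRk N.E - N.intRk J := by
  rcases U.eq_empty_or_nonempty with rfl | ⟨Y₀, hY₀⟩
  · simpa using intRk_mono hJ
  have hmin : ∀ Y ∈ U, ∃ a ≤ Y, Minimal (· ∈ U) a := fun Y hY ↦
    U.finite_toSet.exists_le_minimal hY
  let A := U.filter (Minimal (· ∈ U))
  have hA : U = Finset.univ.filter (fun Y ↦ ∃ a ∈ A, a ≤ Y) := by
    ext Y
    simp only [A, Finset.mem_filter, Finset.mem_univ, true_and]
    constructor
    · intro hY
      obtain ⟨a, haY, ha⟩ := hmin Y hY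
      exact ⟨a, ⟨ha.prop, ha⟩, haY⟩
    · rintro ⟨a, ⟨ha, _⟩, haY⟩
      exact hU haY ha
  have hanti : IsAntichain (· ≤ ·) (A : Set N.CyclicFlats) := by
    intro a ha b hb hab hle
    simp only [A, Finset.coe_filter, Set.mem_ofPred_eq] at ha hb
    exact hab (hb.2.eq_of_le ha.1 hle)
  have hne : A.Nonempty := by
    obtain ⟨a, -, ha⟩ := hmin Y₀ hY₀
    exact ⟨a, by simp [A, ha, ha.prop]⟩
  have h1 := h.sum_le_of_antichain hβ A hanti hne
  rw [← hA] at h1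
  have h2 : N.intRk J ≤ N.intRk (⋂ a ∈ A, a.1) :=
    intRk_mono (Set.subset_iInter₂ fun a ha ↦ hJU a (Finset.mem_of_mem_filter a ha))
  linarith

/-- The flat of loops, as a cyclic flat. -/
def loopsCyclicFlat (N : Matroid α) : N.CyclicFlats :=
  ⟨N.loops, isCyclicFlat_iff.2 ⟨N.isFlat_closure ∅, fun e he ↦
    ⟨{e}, by simpa using he, singleton_isCircuit.2 he, rfl⟩⟩⟩

theorem loopsCyclicFlat_le (X : N.CyclicFlats) : N.loopsCyclicFlat ≤ X := X.2.1.loops_subset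

theorem IsCircuit.isCyclicFlat_closure {K : Set α} (hK : M.IsCircuit K) :
    M.IsCyclicFlat (M.closure K) := by
  refine isCyclicFlat_iff.2 ⟨M.isFlat_closure K, fun e he ↦ ?_⟩
  by_cases heK : e ∈ K
  · exact ⟨K, M.subset_closure K hK.subset_ground, hK, heK⟩
  · obtain ⟨D, hD, h1⟩ := exists_isCircuit_of_mem_closure he heK
    exact ⟨D, hD.trans (Set.insert_subset he (M.subset_closure K hK.subset_ground)), h1⟩

open Classical in
theorem isTransversal_of_weights [N.Finite] [Fintype N.CyclicFlats] {β : N.CyclicFlats → ℤ}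
    (hβ : ∀ X, ∑ Y with X ≤ Y, β Y = N.intRk N.E - N.intRk X.1) (hpos : ∀ X, 0 ≤ β X)
    (hle : ∀ J ⊆ N.E, ∑ Y with J ⊆ Y.1, β Y ≤ N.intRk N.E - N.intRk J) :
    N.IsTransversal := by
  let ι := (F : N.CyclicFlats) × Fin (β F).toNat
  suffices hι : ∀ I : Set α, N.Indep I ↔
      ∃ f : I → ι, Function.Injective f ∧ ∀ e : I, (e : α) ∈ N.E \ (f e).1.1 by
    let φ := Fintype.equivFin ι
    refine ⟨Fintype.card ι, fun i ↦ N.E \ (φ.symm i).1.1, fun i ↦ Set.sdiff_subset, fun I ↦ ?_⟩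
    rw [hι]
    constructor
    · rintro ⟨f, hf, h⟩
      exact ⟨φ ∘ f, φ.injective.comp hf, by simpa using h⟩
    · rintro ⟨f, hf, h⟩
      exact ⟨φ.symm ∘ f, φ.symm.injective.comp hf, h⟩
  -- The loops form the least cyclic flat, of rank 0, so its defining equation gives the total
  -- weight.
  have htot : ∑ Y, β Y = N.intRk N.E := by
    have h1 := hβ N.loopsCyclicFlat
    simp only [loopsCyclicFlat_le, Finset.filter_true] at h1
    have h2 : N.intRk N.loopsCyclicFlat.1 = 0 := by
      simp [loopsCyclicFlat, intRk]
    rw [h1, h2, sub_zero]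
  have hcard : ∀ J : Set α, ((Finset.univ.filter (fun i : ι ↦ ¬ J ⊆ i.1.1)).card : ℤ)
      = N.intRk N.E - ∑ Y with J ⊆ Y.1, β Y := by
    intro J
    have h1 : Finset.univ.filter (fun i : ι ↦ ¬ J ⊆ i.1.1)
        = (Finset.univ.filter (fun Y : N.CyclicFlats ↦ ¬ J ⊆ Y.1)).sigma
          (fun F ↦ (Finset.univ : Finset (Fin (β F).toNat))) := by
      ext i
      rw [Finset.mem_sigma]
      simp
    rw [h1, Finset.card_sigma, ← htot, ← Finset.sum_filter_add_sum_filter_not Finset.univ (fun Y ↦ J ⊆ Y.1)]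
    simp [hpos]
  intro I
  let t : I → Finset ι := fun e ↦ Finset.univ.filter (fun i ↦ (e : α) ∉ i.1.1)
  have ht : ∀ s : Finset I, s.biUnion t
      = Finset.univ.filter (fun i : ι ↦ ¬ ((s.map (.subtype _) : Finset α) : Set α) ⊆ i.1.1) := by
    intro s
    ext i
    simp [t, Set.not_subset]
  have hall := Finset.all_card_le_biUnion_card_iff_exists_injective t
  constructor
  · intro hI
    obtain ⟨f, hf, hft⟩ := hall.1 fun s ↦ by
      have hs : N.Indep ((s.map (.subtype _) : Finset α) : Set α) :=
        hI.subset (by intro e; simp +contextual)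
      have h1 := hle _ hs.subset_ground
      have h2 := hcard ((s.map (.subtype _) : Finset α) : Set α)
      rw [hs.intRk_eq, Finset.card_map] at h1
      rw [ht]
      rw [← Int.ofNat_le]
      linarith
    exact ⟨f, hf, fun e ↦ ⟨hI.subset_ground e.2, by simpa [t] using hft e⟩⟩
  · rintro ⟨f, hf, h⟩
    have hIE : I ⊆ N.E := fun e he ↦ (h ⟨e, he⟩).1
    by_contra hI
    obtain ⟨K, hKI, hK⟩ := ((not_indep_iff hIE).1 hI).exists_isCircuit_subset
    have hKfin : K.Finite := N.ground_finite.subset hK.subset_ground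
    lift K to Finset α using hKfin
    let s : Finset I := K.subtype (· ∈ I)
    have hs : s.map (.subtype _) = K := Finset.subtype_map_of_mem hKI
    have h1 := hall.2 ⟨f, hf, fun e ↦ by simpa [t] using (h e).2⟩ s
    rw [ht, hs, ← Finset.card_map (.subtype _), hs] at h1
    have h2 := hcard (K : Set α)
    -- The closure of a circuit is a cyclic flat, so the bound is an equality here: only r(K) < |K|
    -- members of the family meet `K`, against Hall's condition.
    have h3 : ∑ Y : N.CyclicFlats with (K : Set α) ⊆ Y.1, β Y = N.intRk N.E - N.intRk K := by
      rw [← N.intRk_closure K]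
      rw [← hβ ⟨N.closure K, hK.isCyclicFlat_closure⟩]
      refine Finset.sum_congr (Finset.filter_congr fun Y _ ↦ ?_) fun _ _ ↦ rfl
      change _ ↔ N.closure K ⊆ Y.1
      exact ⟨fun h ↦ (N.closure_subset_closure h).trans_eq Y.closure_eq,
        (N.subset_closure _ hK.subset_ground).trans⟩
    have h4 := hK.intRk_lt
    rw [← Int.ofNat_le] at h1
    linarith

theorem IsPlanarArrangement.isTransversal [N.Finite] (h : N.IsPlanarArrangement f m) :
    N.IsTransversal := by
  classical
  have := Fintype.ofFinite N.CyclicFlats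
  -- Nonnegativity of β(X) comes from comparing the bound for the cyclic flats strictly above X with
  -- the exact sum over those at or above X.
  obtain ⟨β, hβ⟩ := exists_sum_le_eq fun X : N.CyclicFlats ↦ N.intRk N.E - N.intRk X.1
  refine isTransversal_of_weights hβ (fun X ↦ ?_) fun J hJ ↦ ?_
  · have h1 : ∑ Y with X < Y, β Y ≤ N.intRk N.E - N.intRk X.1 :=
      h.sum_le_of_isUpperSet hβ X.subset_ground
        (fun Y Z hYZ hY ↦ by simpa using lt_of_lt_of_le (by simpa using hY) hYZ)
        (fun Y hY ↦ le_of_lt (a := X) (b := Y) (by simpa using hY))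
    have h2 : Finset.univ.filter (X ≤ ·) = insert X (Finset.univ.filter (X < ·)) := by
      ext y
      simp [le_iff_eq_or_lt, eq_comm]
    have h3 := hβ X
    rw [h2, Finset.sum_insert (by simp)] at h3
    linarith
  · exact h.sum_le_of_isUpperSet hβ hJ
      (fun Y Z hYZ hY ↦ by
        simp only [Finset.coe_filter, Finset.mem_univ, true_and, Set.mem_ofPred_eq] at hY ⊢
        exact hY.trans hYZ)
      (fun Y hY ↦ by simpa using hY)

end Matroid

/-! ### Planar orders from dimension two and distributivity -/

/-- A map `f` from a lattice to a chain under which any three pairwise incomparable elements,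
listed in the order of their images, behave as in a planar distributive lattice. -/
structure IsPlanarOrder {L C : Type*} [Lattice L] [LinearOrder C] (f : L → C) : Prop where
  le_sup : ∀ x y z, IncompRel (· ≤ ·) x y → IncompRel (· ≤ ·) y z → IncompRel (· ≤ ·) x z →
    f x ≤ f y → f y ≤ f z → y ≤ x ⊔ z
  inf_le : ∀ x y z, IncompRel (· ≤ ·) x y → IncompRel (· ≤ ·) y z → IncompRel (· ≤ ·) x z →
    f x ≤ f y → f y ≤ f z → x ⊓ z ≤ y
  le_inf_sup : ∀ x y z, IncompRel (· ≤ ·) x y → IncompRel (· ≤ ·) y z → IncompRel (· ≤ ·) x z →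
    f x ≤ f y → f y ≤ f z → y ≤ (x ⊓ y) ⊔ z
  sup_inf_le : ∀ x y z, IncompRel (· ≤ ·) x y → IncompRel (· ≤ ·) y z → IncompRel (· ≤ ·) x z →
    f x ≤ f y → f y ≤ f z → (x ⊔ y) ⊓ z ≤ y

theorem IsPlanarOrder.comp_dual {L K C : Type*} [Lattice L] [Lattice K] [LinearOrder C] {f : L → C}
    (h : IsPlanarOrder f) (e : K ≃o Lᵒᵈ) :
    IsPlanarOrder (fun x ↦ f (OrderDual.ofDual (e x))) := by
  have he : ∀ {x y : K}, x ≤ y ↔ OrderDual.ofDual (e y) ≤ OrderDual.ofDual (e x) := fun {x y} ↦ by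
    rw [OrderDual.ofDual_le_ofDual, e.le_iff_le]
  have hinc : ∀ {x y : K}, IncompRel (· ≤ ·) x y →
      IncompRel (· ≤ ·) (OrderDual.ofDual (e x)) (OrderDual.ofDual (e y)) :=
    fun hxy ↦ ⟨fun h ↦ hxy.2 (he.2 h), fun h ↦ hxy.1 (he.2 h)⟩
  constructor <;> intro x y z hxy hyz hxz h1 h2 <;> rw [he]
  · simpa using h.inf_le _ _ _ (hinc hxy) (hinc hyz) (hinc hxz) h1 h2
  · simpa using h.le_sup _ _ _ (hinc hxy) (hinc hyz) (hinc hxz) h1 h2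
  · simpa using h.sup_inf_le _ _ _ (hinc hxy) (hinc hyz) (hinc hxz) h1 h2
  · simpa using h.le_inf_sup _ _ _ (hinc hxy) (hinc hyz) (hinc hxz) h1 h2

theorem exists_orderEmbedding_of_orderDimension_le_two {P : Type u} [PartialOrder P]
    (h : orderDimension P ≤ 2) :
    ∃ n ≤ 2, ∃ (C : Fin n → Type u) (_ : ∀ i, LinearOrder (C i)), Nonempty (P ↪o ∀ i, C i) := by
  have hne : {d : ℕ∞ | ∃ n : ℕ, d = n ∧ ∃ (C : Fin n → Type u) (_ : ∀ i, LinearOrder (C i)),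
      Nonempty (P ↪o ∀ i, C i)}.Nonempty := by
    by_contra hemp
    rw [Set.not_nonempty_iff_eq_empty] at hemp
    rw [orderDimension, hemp, sInf_empty] at h
    simp at h
  obtain ⟨n, hn, hC⟩ := csInf_mem hne
  refine ⟨n, ?_, hC⟩
  rw [orderDimension, hn] at h
  exact_mod_cast h

/-- An ordered set of dimension at most two embeds its pairwise incomparable elements in a chain
so that any upper bound of two of them bounds those in between, and dually. -/
theorem exists_betweenness_of_orderDimension_le_two {P : Type u} [PartialOrder P]
    (h : orderDimension P ≤ 2) : ∃ (C : Type u) (_ : LinearOrder C) (f : P → C),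
      ∀ x y z, IncompRel (· ≤ ·) x y → IncompRel (· ≤ ·) y z → f x ≤ f y → f y ≤ f z →
        (∀ w, x ≤ w → z ≤ w → y ≤ w) ∧ ∀ w, w ≤ x → w ≤ z → w ≤ y := by
  obtain ⟨n, hn, C, _, ⟨φ⟩⟩ := exists_orderEmbedding_of_orderDimension_le_two h
  have hφ : ∀ x y : P, x ≤ y ↔ ∀ i, φ x i ≤ φ y i := fun x y ↦ φ.le_iff_le.symm
  interval_cases n
  · exact ⟨PUnit, inferInstance, fun _ ↦ ⟨⟩, fun x y z hxy _ ↦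
      (hxy.1 ((hφ x y).2 fun i ↦ i.elim0)).elim⟩
  · refine ⟨PUnit, inferInstance, fun _ ↦ ⟨⟩, fun x y z hxy _ ↦ ?_⟩
    rcases le_total (φ x 0) (φ y 0) with h1 | h1
    · exact (hxy.1 ((hφ x y).2 (Fin.forall_fin_one.2 h1))).elim
    · exact (hxy.2 ((hφ y x).2 (Fin.forall_fin_one.2 h1))).elim
  · refine ⟨C 0, inferInstance, fun x ↦ φ x 0, fun x y z hxy hyz h1 h2 ↦ ?_⟩
    -- On incomparable elements the two coordinates run in opposite directions, so a middle element
    -- is bounded by one neighbour in each coordinate.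
    have key : ∀ a b : P, IncompRel (· ≤ ·) a b → φ a 0 ≤ φ b 0 → φ b 1 ≤ φ a 1 := by
      intro a b hab h3
      by_contra h4
      exact hab.1 ((hφ a b).2 (Fin.forall_fin_two.2 ⟨h3, (not_le.1 h4).le⟩))
    have h3 := key x y hxy h1
    have h4 := key y z hyz h2
    simp only [hφ, Fin.forall_fin_two]
    exact ⟨fun w hx hz ↦ ⟨h2.trans hz.1, h3.trans hx.2⟩,
      fun w hx hz ↦ ⟨hx.1.trans h1, hz.2.trans h4⟩⟩

theorem inf_sup_left_of_generatedSublattice {L : Type u} [Lattice L] {A : Set L}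
    (h : IsDistributiveLattice (generatedSublattice A)) {x y z : L} (hx : x ∈ A) (hy : y ∈ A)
    (hz : z ∈ A) : x ⊓ (y ⊔ z) = (x ⊓ y) ⊔ (x ⊓ z) :=
  congrArg Subtype.val (h ⟨x, subset_latticeClosure hx⟩ ⟨y, subset_latticeClosure hy⟩
    ⟨z, subset_latticeClosure hz⟩)

theorem exists_isPlanarOrder {L : Type u} [Lattice L] (hdim : orderDimension L ≤ 2)
    (hdistrib : ∀ A : Set L, IsAntichain (· ≤ ·) A →
      IsDistributiveLattice (generatedSublattice A)) :
    ∃ (C : Type u) (_ : LinearOrder C) (f : L → C), IsPlanarOrder f := by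
  obtain ⟨C, _, f, hf⟩ := exists_betweenness_of_orderDimension_le_two hdim
  have hanti : ∀ {x y z : L}, IncompRel (· ≤ ·) x y → IncompRel (· ≤ ·) y z →
      IncompRel (· ≤ ·) x z → IsAntichain (· ≤ ·) ({x, y, z} : Set L) := by
    rintro x y z ⟨h1, h2⟩ ⟨h3, h4⟩ ⟨h5, h6⟩ a (rfl | rfl | rfl) b (rfl | rfl | rfl) hab <;>
      first | exact absurd rfl hab | assumption
  refine ⟨C, _, f, fun x y z hxy hyz _ h1 h2 ↦ (hf x y z hxy hyz h1 h2).1 _ le_sup_left le_sup_right,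
    fun x y z hxy hyz _ h1 h2 ↦ (hf x y z hxy hyz h1 h2).2 _ inf_le_left inf_le_right,
    fun x y z hxy hyz hxz h1 h2 ↦ ?_, fun x y z hxy hyz hxz h1 h2 ↦ ?_⟩
  · have h3 : y ≤ x ⊔ z := (hf x y z hxy hyz h1 h2).1 _ le_sup_left le_sup_right
    calc y = y ⊓ (x ⊔ z) := (inf_eq_left.2 h3).symm
      _ = (y ⊓ x) ⊔ (y ⊓ z) := inf_sup_left_of_generatedSublattice
          (hdistrib _ (hanti hxy hyz hxz)) (by simp) (by simp) (by simp)
      _ ≤ (x ⊓ y) ⊔ z := sup_le_sup (inf_comm y x).le inf_le_right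
  · have h3 : x ⊓ z ≤ y := (hf x y z hxy hyz h1 h2).2 _ inf_le_left inf_le_right
    calc (x ⊔ y) ⊓ z = z ⊓ (x ⊔ y) := inf_comm ..
      _ = (z ⊓ x) ⊔ (z ⊓ y) := inf_sup_left_of_generatedSublattice
          (hdistrib _ (hanti hxy hyz hxz)) (by simp) (by simp) (by simp)
      _ ≤ y := sup_le (inf_comm z x ▸ h3) inf_le_right

/-! ### Duals and minors -/

namespace Matroid

variable {α : Type u} {M N : Matroid α}

/-- Coloops of M|X are loops of its dual, the contraction of M✶ by E \ X; having none says that E \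
X is closed in M✶. -/
theorem isCyclicFlat_iff_dual {X : Set α} (hX : X ⊆ M.E) :
    M.IsCyclicFlat X ↔ M.IsFlat X ∧ M✶.IsFlat (M.E \ X) := by
  refine and_congr_right fun _ ↦ ?_
  have h1 : ∀ e, (M ↾ X).IsColoop e ↔ e ∈ M✶.closure (M.E \ X) ∧ e ∉ M.E \ X := fun e ↦ by
    rw [← contract_isLoop_iff_mem_closure, ← dual_delete, dual_isLoop_iff_isColoop,
      delete_compl hX]
  simp only [h1, not_and_not_right, isFlat_iff_closure_eq]
  exact ⟨fun h ↦ Set.Subset.antisymm h (M✶.subset_closure _ Set.sdiff_subset), fun h ↦ h.subset⟩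

theorem IsCyclicFlat.dual {X : Set α} (h : M.IsCyclicFlat X) : M✶.IsCyclicFlat (M.E \ X) := by
  have hX := h.1.subset_ground
  rw [isCyclicFlat_iff_dual hX] at h
  rw [isCyclicFlat_iff_dual (M := M✶) (show M.E \ X ⊆ M✶.E from Set.sdiff_subset)]
  simpa [Set.inter_eq_self_of_subset_right hX] using h.symm

/-- The cyclic flats of the dual are the complements of the cyclic flats. -/
def cyclicFlatsDual (M : Matroid α) : M✶.CyclicFlats ≃o (M.CyclicFlats)ᵒᵈ where
  toFun X := OrderDual.toDual ⟨M.E \ X.1, by simpa using X.2.dual⟩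
  invFun X := ⟨M.E \ X.ofDual.1, X.ofDual.2.dual⟩
  left_inv X := Subtype.ext (Set.sdiff_sdiff_cancel_left X.2.1.subset_ground)
  right_inv X := Subtype.ext (Set.sdiff_sdiff_cancel_left X.ofDual.2.1.subset_ground)
  map_rel_iff' {X Y} := by
    change M.E \ Y.1 ⊆ M.E \ X.1 ↔ X.1 ⊆ Y.1
    exact Set.sdiff_subset_sdiff_iff_subset Y.2.1.subset_ground X.2.1.subset_ground

/-- The largest cyclic flat of `M` contained in `F ∪ D`, for a cyclic flat `F` of `M ／ D`. -/
def cyclicFlatOfContract {D : Set α} (F : (M ／ D).CyclicFlats) : M.CyclicFlats :=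
  ⟨⋃₀ {K | M.IsCircuit K ∧ K ⊆ F.1 ∪ D}, by
    refine isCyclicFlat_iff.2 ⟨isFlat_iff_closure_eq.2 (Set.Subset.antisymm (fun e he ↦ ?_)
      (M.subset_closure _ (Set.sUnion_subset fun K hK ↦ hK.1.subset_ground))), ?_⟩
    · by_contra hne
      obtain ⟨K, hK, hKc, heK⟩ := exists_isCircuit_of_mem_closure he hne
      have hsub : ⋃₀ {K | M.IsCircuit K ∧ K ⊆ F.1 ∪ D} ⊆ F.1 ∪ D :=
        Set.sUnion_subset fun K hK ↦ hK.2
      have heF : e ∈ F.1 ∪ D := by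
        by_cases heD : e ∈ D
        · exact .inr heD
        left
        rw [← F.closure_eq, contract_closure_eq]
        exact ⟨M.closure_subset_closure hsub he, heD⟩
      exact hne ⟨K, ⟨hKc, hK.trans (Set.insert_subset heF hsub)⟩, heK⟩
    · rintro e ⟨K, hK, heK⟩
      exact ⟨K, Set.subset_sUnion_of_mem hK, hK.1, heK⟩⟩

theorem coe_cyclicFlatOfContract_sdiff {D : Set α} (F : (M ／ D).CyclicFlats) :
    (cyclicFlatOfContract F).1 \ D = F.1 := by
  refine Set.Subset.antisymm ?_ fun e he ↦ ⟨?_, (F.subset_ground he).2⟩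
  · rintro e ⟨⟨K, hK, heK⟩, heD⟩
    exact (hK.2 heK).resolve_right heD
  · obtain ⟨K, hKF, hK, heK⟩ := (isCyclicFlat_iff.1 F.2).2 e he
    obtain ⟨K', hK', hKK', hK'u⟩ := hK.exists_subset_isCircuit_of_contract
    exact ⟨K', ⟨hK', hK'u.trans (Set.union_subset_union_left _ hKF)⟩, hKK' heK⟩

theorem cyclicFlatOfContract_le_iff {D : Set α} {F G : (M ／ D).CyclicFlats} :
    cyclicFlatOfContract F ≤ cyclicFlatOfContract G ↔ F ≤ G := by
  constructor
  · intro h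
    change F.1 ⊆ G.1
    rw [← coe_cyclicFlatOfContract_sdiff F, ← coe_cyclicFlatOfContract_sdiff G]
    exact Set.sdiff_subset_sdiff_left h
  · exact fun h ↦ Set.sUnion_subset_sUnion fun K hK ↦
      ⟨hK.1, hK.2.trans (Set.union_subset_union_left _ h)⟩

/-- Cyclic flats of M ／ D embed in those of M, and removing D recovers them. Relations y ≤ S ∨ T in
M survive because closure in M ／ D is closure in M after adjoining D, with D then removed. -/
theorem _root_.IsPlanarOrder.isPlanarArrangement_contract {C : Type*} [LinearOrder C]
    {f : M.CyclicFlats → C} (h : IsPlanarOrder f) (D : Set α) :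
    (M ／ D).IsPlanarArrangement (fun F ↦ f (cyclicFlatOfContract F))
      (fun F G ↦ (cyclicFlatOfContract F ⊓ cyclicFlatOfContract G).1 \ D) := by
  have hinc : ∀ {F G : (M ／ D).CyclicFlats}, IncompRel (· ≤ ·) F G →
      IncompRel (· ≤ ·) (cyclicFlatOfContract F) (cyclicFlatOfContract G) := fun hFG ↦
    ⟨fun h ↦ hFG.1 (cyclicFlatOfContract_le_iff.1 h),
      fun h ↦ hFG.2 (cyclicFlatOfContract_le_iff.1 h)⟩
  have hclos : ∀ {y : (M ／ D).CyclicFlats} {S T : Set α},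
      (cyclicFlatOfContract y).1 ⊆ M.closure (S ∪ T) →
      y.1 ⊆ (M ／ D).closure (S \ D ∪ T \ D) := by
    intro y S T hy
    rw [contract_closure_eq, ← coe_cyclicFlatOfContract_sdiff y]
    refine Set.sdiff_subset_sdiff_left (hy.trans (M.closure_subset_closure ?_))
    rw [← Set.union_sdiff_distrib, Set.sdiff_union_self]
    exact Set.subset_union_left
  constructor
  · intro x y
    rw [← coe_cyclicFlatOfContract_sdiff x, ← coe_cyclicFlatOfContract_sdiff y]
    exact Set.subset_inter (Set.sdiff_subset_sdiff_left ((CyclicFlats.inf_subset _ _).trans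
      Set.inter_subset_left)) (Set.sdiff_subset_sdiff_left ((CyclicFlats.inf_subset _ _).trans
      Set.inter_subset_right))
  · intro x y z hxy hyz hxz h1 h2
    have h3 := hclos (h.le_sup _ _ _ (hinc hxy) (hinc hyz) (hinc hxz) h1 h2)
    rwa [coe_cyclicFlatOfContract_sdiff, coe_cyclicFlatOfContract_sdiff] at h3
  · intro x y z hxy hyz hxz h1 h2
    rw [← coe_cyclicFlatOfContract_sdiff y]
    exact Set.sdiff_subset_sdiff_left (h.inf_le _ _ _ (hinc hxy) (hinc hyz) (hinc hxz) h1 h2)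
  · intro x y z hxy hyz hxz h1 h2
    have h3 := hclos (h.le_inf_sup _ _ _ (hinc hxy) (hinc hyz) (hinc hxz) h1 h2)
    rwa [coe_cyclicFlatOfContract_sdiff z] at h3

theorem IsTransversal.delete (h : M.IsTransversal) (D : Set α) : (M ＼ D).IsTransversal := by
  obtain ⟨n, A, -, hA⟩ := h
  refine ⟨n, fun i ↦ A i ∩ (M ＼ D).E, fun i ↦ Set.inter_subset_right, fun I ↦ ?_⟩
  constructor
  · intro hI
    obtain ⟨f, hf, hfA⟩ := (hA I).1 hI.of_delete
    exact ⟨f, hf, fun e ↦ ⟨hfA e, hI.subset_ground e.2⟩⟩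
  · rintro ⟨f, hf, hfA⟩
    rw [delete_indep_iff, hA]
    exact ⟨⟨f, hf, fun e ↦ (hfA e).1⟩, Set.disjoint_left.2 fun e he ↦ (hfA ⟨e, he⟩).2.2⟩

theorem _root_.IsPlanarOrder.isTransversal_of_isMinor [M.Finite] {C : Type*} [LinearOrder C]
    {f : M.CyclicFlats → C} (h : IsPlanarOrder f) (hN : N.IsMinor M) : N.IsTransversal := by
  obtain ⟨D, D', rfl⟩ := hN
  exact (h.isPlanarArrangement_contract D).isTransversal.delete D'

theorem IsMinor.dual_isMinor (hN : N.IsMinor M) : N✶.IsMinor M✶ := by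
  obtain ⟨D, D', rfl⟩ := hN
  -- `D` and `D'` may overlap, hence the difference when the two operations are swapped.
  exact ⟨D' \ D, D, by rw [dual_contract_delete, delete_contract_comm']⟩

end Matroid

theorem mainTheorem3 {α : Type u} (M : Matroid α) [M.Finite]
    (hdim : orderDimension M.CyclicFlats ≤ 2)
    (hdistrib : ∀ A : Set M.CyclicFlats, IsAntichain (· ≤ ·) A →
      IsDistributiveLattice (generatedSublattice A)) :
    (M.IsTransversal ∧ M✶.IsTransversal) ∧
      ∀ N : Matroid α, N.IsMinor M → N.IsTransversal ∧ N✶.IsTransversal := by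
  obtain ⟨C, _, f, hf⟩ := exists_isPlanarOrder hdim hdistrib
  have key : ∀ N : Matroid α, N.IsMinor M → N.IsTransversal ∧ N✶.IsTransversal := fun N hN ↦
    ⟨hf.isTransversal_of_isMinor hN,
      (hf.comp_dual M.cyclicFlatsDual).isTransversal_of_isMinor hN.dual_isMinor⟩
  exact ⟨key M .refl, key⟩
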